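/- An Orlicz function is a continuous, non-decreasing, convex function $M:[0,\infty)\to\mathbb R$ with $M(0)=0$ and $\lim_{t\to\infty}M(t)=\infty$; it is non-degenerate if $M(t)>0$ for all $t>0$, and a non-degenerate $M$ satisfies the $\Delta_2$ condition at zero if $\liminf_{t\downarrow 0} M(t)/M(2t)>0$. For a bounded real sequence $x=(x_n)$ put $\sigma_M(x)=\sum_n M(|x_n|)\in[0,\infty]$. The Orlicz sequence space $\ell_M$ consists of all bounded real sequences $x$ such that $\sigma_M(x/\rho)<\infty$ for some $\rho>0$, with the norm $\|x\|=\inf\{\rho>0:\sigma_M(x/\rho)\le 1\}$. A bump on a real normed space $X$ is a continuous function $b:X\to\mathbb R$ whose support $\{x: b(x)\ne 0\}$ is nonempty and bounded. A function $b:X\to\mathbb R$ is twice Gâteaux differentiable if for every $x\in X$ there are a bounded linear functional $b'(x)$ and a bounded bilinear form $b''(x)$ on $X$ such that, for all $x,h,k\in X$, $$\lim_{t\to0}\frac{b(x+th)-b(x)}{t}=b'(x)(h),\qquad \lim_{t\to0}\frac{b'(x+th)(k)-b'(x)(k)}{t}=b''(x)(h,k).$$ **Proposition.** Let $M$ be a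 non-degenerate Orlicz function that is twice differentiable on $(0,\infty)$, satisfies the $\Delta_2$ condition at zero, and has $\lim_{t\downarrow0}M''(t)=\infty$. Then there is no twice Gâteaux differentiable bump on $\ell_M$. In particular, for $1<p<2$ there is no twice Gâteaux differentiable bump on $\ell_p$. -/

import Mathlib

open Set Filter Topology
open scoped ENNReal

/-- An Orlicz function: a continuous, non-decreasing, convex function on `[0, ∞)` with `M 0 = 0` and
`M t → ∞` as `t → ∞`. It is carried by a function on `ℝ` of which only the values on `[0, ∞)` are
ever used. -/
structure OrliczFunction where
  /-- The underlying function. -/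
  toFun : ℝ → ℝ
  continuousOn : ContinuousOn toFun (Ici 0)
  monotoneOn : MonotoneOn toFun (Ici 0)
  convexOn : ConvexOn ℝ (Ici 0) toFun
  map_zero : toFun 0 = 0
  tendsto_atTop : Tendsto toFun atTop atTop

namespace OrliczFunction

instance instCoeFun : CoeFun OrliczFunction (fun _ => ℝ → ℝ) := ⟨toFun⟩

variable (M : OrliczFunction)

/-- `M` is degenerate if `M t = 0` for some `t > 0`. -/
def IsDegenerate : Prop := ∃ t : ℝ, 0 < t ∧ M t = 0

/-- The `Δ₂` condition at zero. -/
def DeltaTwoAtZero : Prop := 0 < liminf (fun t : ℝ => M t / M (2 * t)) (𝓝[>] 0)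

/-- `M` is twice differentiable at every `t > 0`. -/
def IsTwiceDifferentiable : Prop :=
  ∀ t : ℝ, 0 < t → DifferentiableAt ℝ M t ∧ DifferentiableAt ℝ (deriv M) t

/-- `σ_M(x) = ∑ₙ M(|xₙ|) ∈ [0, ∞]`. -/
noncomputable def sigma (x : ℕ → ℝ) : ℝ≥0∞ := ∑' n, ENNReal.ofReal (M |x n|)

theorem nonneg {t : ℝ} (ht : 0 ≤ t) : 0 ≤ M t := by
  have h := M.monotoneOn (mem_Ici.2 le_rfl) (mem_Ici.2 ht) ht
  rwa [M.map_zero] at h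

theorem map_abs_combo_le {a b : ℝ} (ha : 0 ≤ a) (hb : 0 ≤ b) (hab : a + b = 1) (s t : ℝ) :
    M |a * s + b * t| ≤ a * M |s| + b * M |t| := by
  have h1 : |a * s + b * t| ≤ a * |s| + b * |t| := by
    calc |a * s + b * t| ≤ |a * s| + |b * t| := abs_add_le _ _
      _ = a * |s| + b * |t| := by rw [abs_mul, abs_mul, abs_of_nonneg ha, abs_of_nonneg hb]
  have h2 := M.monotoneOn (mem_Ici.2 (abs_nonneg _))
    (mem_Ici.2 (le_trans (abs_nonneg _) h1)) h1
  have h3 := M.convexOn.2 (mem_Ici.2 (abs_nonneg s)) (mem_Ici.2 (abs_nonneg t)) ha hb hab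
  simp only [smul_eq_mul] at h3
  exact h2.trans h3

theorem sigma_combo_le {a b : ℝ} (ha : 0 ≤ a) (hb : 0 ≤ b) (hab : a + b = 1) (x y : ℕ → ℝ) :
    M.sigma (a • x + b • y) ≤ ENNReal.ofReal a * M.sigma x + ENNReal.ofReal b * M.sigma y := by
  unfold sigma
  rw [← ENNReal.tsum_mul_left, ← ENNReal.tsum_mul_left, ← ENNReal.tsum_add]
  refine ENNReal.tsum_le_tsum fun n => ?_
  rw [← ENNReal.ofReal_mul ha, ← ENNReal.ofReal_mul hb,
    ← ENNReal.ofReal_add (mul_nonneg ha (M.nonneg (abs_nonneg _)))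
      (mul_nonneg hb (M.nonneg (abs_nonneg _)))]
  exact ENNReal.ofReal_le_ofReal (by simpa using M.map_abs_combo_le ha hb hab (x n) (y n))

theorem sigma_zero : M.sigma 0 = 0 := by simp [sigma, M.map_zero]

theorem sigma_smul_le {a : ℝ} (ha : 0 ≤ a) (ha1 : a ≤ 1) (x : ℕ → ℝ) :
    M.sigma (a • x) ≤ ENNReal.ofReal a * M.sigma x := by
  have h := M.sigma_combo_le ha (sub_nonneg.2 ha1) (by ring) x 0
  simpa [M.sigma_zero] using h

theorem sigma_abs_smul (a : ℝ) (x : ℕ → ℝ) : M.sigma (|a| • x) = M.sigma (a • x) := by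
  simp [sigma, abs_mul]

theorem sigma_smul_mono {a b : ℝ} (ha : 0 ≤ a) (hab : a ≤ b) (x : ℕ → ℝ) :
    M.sigma (a • x) ≤ M.sigma (b • x) := by
  refine ENNReal.tsum_le_tsum fun n => ENNReal.ofReal_le_ofReal ?_
  refine M.monotoneOn (mem_Ici.2 (abs_nonneg _)) (mem_Ici.2 (abs_nonneg _)) ?_
  simp only [Pi.smul_apply, smul_eq_mul, abs_mul, abs_of_nonneg ha, abs_of_nonneg (ha.trans hab)]
  gcongr

/-- `ℓ_M` as a linear subspace: the bounded real sequences `x` with `σ_M(x / ρ) < ∞` for some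
`ρ > 0`. -/
noncomputable def seqSubmodule : Submodule ℝ (ℕ → ℝ) where
  carrier := {x | Memℓp x ∞ ∧ ∃ ρ : ℝ, 0 < ρ ∧ M.sigma (ρ⁻¹ • x) < ∞}
  zero_mem' := ⟨zero_memℓp, 1, one_pos, by simp [M.sigma_zero]⟩
  add_mem' := by
    rintro x y ⟨hx, r, hr, hxr⟩ ⟨hy, s, hs, hys⟩
    refine ⟨hx.add hy, r + s, add_pos hr hs, ?_⟩
    have h := M.sigma_combo_le (a := r / (r + s)) (b := s / (r + s)) (by positivity)
      (by positivity) (by field_simp) (r⁻¹ • x) (s⁻¹ • y)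
    have e : (r / (r + s)) • r⁻¹ • x + (s / (r + s)) • s⁻¹ • y = (r + s)⁻¹ • (x + y) := by
      ext n
      simp only [Pi.add_apply, Pi.smul_apply, smul_eq_mul]
      field_simp
    rw [e] at h
    exact h.trans_lt (ENNReal.add_lt_top.2
      ⟨ENNReal.mul_lt_top ENNReal.ofReal_lt_top hxr, ENNReal.mul_lt_top ENNReal.ofReal_lt_top hys⟩)
  smul_mem' := by
    rintro c x ⟨hx, r, hr, hxr⟩
    refine ⟨hx.const_smul c, r * (|c| + 1), by positivity, ?_⟩
    refine lt_of_le_of_lt ?_ hxr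
    rw [smul_smul, ← M.sigma_abs_smul]
    refine M.sigma_smul_mono (abs_nonneg _) ?_ x
    rw [abs_mul, abs_inv, abs_of_pos (show 0 < r * (|c| + 1) by positivity), mul_inv, mul_assoc]
    refine mul_le_of_le_one_right (by positivity) ?_
    rw [inv_mul_le_iff₀ (by positivity)]
    linarith

/-- The Orlicz sequence space `ℓ_M`; as a type of its own, it does not inherit the topology of
pointwise convergence from `ℕ → ℝ`. -/
def Space : Type := M.seqSubmodule

noncomputable instance Space.instAddCommGroup : AddCommGroup M.Space := inferInstanceAs (AddCommGroup M.seqSubmodule)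

noncomputable instance Space.instModule : Module ℝ M.Space := inferInstanceAs (Module ℝ M.seqSubmodule)

variable {M}

/-- The sequence of coordinates of an element of `ℓ_M`. -/
def Space.coords (x : M.Space) : ℕ → ℝ := x.1

theorem Space.coords_zero : (0 : M.Space).coords = 0 := rfl

theorem Space.coords_add (x y : M.Space) : (x + y).coords = x.coords + y.coords := rfl

theorem Space.coords_smul (c : ℝ) (x : M.Space) : (c • x).coords = c • x.coords := rfl

theorem Space.coords_injective : Function.Injective (Space.coords (M := M)) :=
  Subtype.coe_injective

/-- The Luxemburg norm `‖x‖ = inf {ρ > 0 : σ_M(x / ρ) ≤ 1}`. -/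
noncomputable instance Space.instNorm : Norm M.Space :=
  ⟨fun x => sInf {ρ : ℝ | 0 < ρ ∧ M.sigma (ρ⁻¹ • x.coords) ≤ 1}⟩

theorem Space.norm_def (x : M.Space) :
    ‖x‖ = sInf {ρ : ℝ | 0 < ρ ∧ M.sigma (ρ⁻¹ • x.coords) ≤ 1} := rfl

/-- The set `{x ∈ ℓ_M : σ_M(x) ≤ 1}`, of which the norm is the Minkowski functional. -/
def Space.modularBall (M : OrliczFunction) : Set M.Space := {x | M.sigma x.coords ≤ 1}

theorem Space.norm_eq_gauge (x : M.Space) : ‖x‖ = gauge (Space.modularBall M) x := by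
  rw [gauge_def']
  rfl

theorem Space.convex_modularBall : Convex ℝ (Space.modularBall M) := by
  intro x hx y hy a b ha hb hab
  refine (M.sigma_combo_le ha hb hab x.coords y.coords).trans ?_
  have hx' : M.sigma x.coords ≤ 1 := hx
  have hy' : M.sigma y.coords ≤ 1 := hy
  calc ENNReal.ofReal a * M.sigma x.coords + ENNReal.ofReal b * M.sigma y.coords
      ≤ ENNReal.ofReal a * 1 + ENNReal.ofReal b * 1 := by gcongr
    _ = 1 := by rw [mul_one, mul_one, ← ENNReal.ofReal_add ha hb, hab, ENNReal.ofReal_one]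

theorem Space.balanced_modularBall : Balanced ℝ (Space.modularBall M) := by
  rw [balanced_iff_smul_mem]
  intro a ha x hx
  rw [Real.norm_eq_abs] at ha
  change M.sigma (a • x.coords) ≤ 1
  rw [← M.sigma_abs_smul]
  refine (M.sigma_smul_mono (abs_nonneg a) ha x.coords).trans ?_
  rw [one_smul]
  exact hx

theorem Space.exists_sigma_le_one (x : M.Space) :
    ∃ ρ : ℝ, 0 < ρ ∧ M.sigma (ρ⁻¹ • x.coords) ≤ 1 := by
  obtain ⟨-, r, hr, hxr⟩ := x.2
  change M.sigma (r⁻¹ • x.coords) < ∞ at hxr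
  obtain ⟨S, hS⟩ : ∃ S : ℝ, S = (M.sigma (r⁻¹ • x.coords)).toReal := ⟨_, rfl⟩
  have hS0 : 0 ≤ S := hS ▸ ENNReal.toReal_nonneg
  have hS' : M.sigma (r⁻¹ • x.coords) = ENNReal.ofReal S := by
    rw [hS, ENNReal.ofReal_toReal hxr.ne]
  refine ⟨(S + 1) * r, by positivity, ?_⟩
  have h := M.sigma_smul_le (a := (S + 1)⁻¹) (by positivity)
    (inv_le_one_of_one_le₀ (by linarith)) (r⁻¹ • x.coords)
  rw [mul_inv, mul_smul]
  refine h.trans ?_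
  rw [hS', ← ENNReal.ofReal_mul (by positivity)]
  refine ENNReal.ofReal_le_one.2 ?_
  rw [inv_mul_le_iff₀ (by positivity)]
  linarith

theorem Space.absorbent_modularBall : Absorbent ℝ (Space.modularBall M) := by
  intro x
  obtain ⟨ρ, hρ, h⟩ := x.exists_sigma_le_one
  refine absorbs_iff_norm.2 ⟨ρ, fun c hc => ?_⟩
  rw [Real.norm_eq_abs] at hc
  have hc0 : c ≠ 0 := abs_pos.1 (hρ.trans_le hc)
  rw [singleton_subset_iff, mem_smul_set_iff_inv_smul_mem₀ hc0]
  change M.sigma (c⁻¹ • x.coords) ≤ 1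
  rw [← M.sigma_abs_smul, abs_inv]
  exact (M.sigma_smul_mono (by positivity) (inv_anti₀ hρ hc) x.coords).trans h

theorem Space.eq_zero_of_norm_eq_zero (x : M.Space) (hx : ‖x‖ = 0) : x = 0 := by
  apply Space.coords_injective
  rw [Space.coords_zero]
  funext n
  by_contra hn
  have hn' : 0 < |x.coords n| := abs_pos.2 hn
  obtain ⟨T, hT⟩ := ((M.tendsto_atTop.eventually_gt_atTop 1).and (eventually_gt_atTop 0)).exists
  have hlt : sInf {ρ : ℝ | 0 < ρ ∧ M.sigma (ρ⁻¹ • x.coords) ≤ 1} < |x.coords n| / T := by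
    rw [← Space.norm_def, hx]
    exact div_pos hn' hT.2
  obtain ⟨ρ, ⟨hρ, hσ⟩, hρT⟩ := exists_lt_of_csInf_lt x.exists_sigma_le_one hlt
  have h1 : T ≤ |(ρ⁻¹ • x.coords) n| := by
    simp only [Pi.smul_apply, smul_eq_mul, abs_mul, abs_inv, abs_of_pos hρ]
    rw [lt_div_iff₀ hT.2] at hρT
    rw [inv_mul_eq_div, le_div_iff₀ hρ]
    linarith
  have h2 := M.monotoneOn (mem_Ici.2 hT.2.le) (mem_Ici.2 (abs_nonneg _)) h1
  have h3 : ENNReal.ofReal (M |(ρ⁻¹ • x.coords) n|) ≤ 1 :=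
    (ENNReal.le_tsum n).trans hσ
  linarith [ENNReal.ofReal_le_one.1 h3, hT.1]

theorem Space.normCore (M : OrliczFunction) : NormedSpace.Core ℝ M.Space where
  norm_nonneg x := by
    rw [Space.norm_eq_gauge]
    exact gauge_nonneg x
  norm_smul c x := by
    rw [Space.norm_eq_gauge, Space.norm_eq_gauge]
    exact gauge_smul Space.balanced_modularBall c x
  norm_triangle x y := by
    simp only [Space.norm_eq_gauge]
    exact gauge_add_le Space.convex_modularBall Space.absorbent_modularBall x y
  norm_eq_zero_iff x := by
    refine ⟨Space.eq_zero_of_norm_eq_zero x, ?_⟩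
    rintro rfl
    rw [Space.norm_eq_gauge, gauge_zero]

noncomputable instance Space.instNormedAddCommGroup : NormedAddCommGroup M.Space := NormedAddCommGroup.ofCore (Space.normCore M)

noncomputable instance Space.instNormedSpace : NormedSpace ℝ M.Space := NormedSpace.ofCore (Space.normCore M)

end OrliczFunction

/-- A bump on a normed space: a continuous real function with nonempty bounded support. -/
structure IsBump {E : Type*} [NormedAddCommGroup E] (b : E → ℝ) : Prop where
  continuous : Continuous b
  support_nonempty : (Function.support b).Nonempty
  isBounded_support : Bornology.IsBounded (Function.support b)

/-- `f` is Gâteaux differentiable at `x` with derivative `f'`, a bounded linear functional: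
`(f (x + t h) - f x) / t → f' h` as `t → 0`, for every direction `h`. -/
def HasGateauxDerivAt {E : Type*} [NormedAddCommGroup E] [NormedSpace ℝ E]
    (f : E → ℝ) (f' : E →L[ℝ] ℝ) (x : E) : Prop :=
  ∀ h : E, HasLineDerivAt ℝ f (f' h) x h

/-- `f` is twice Gâteaux differentiable (everywhere): it has a Gâteaux derivative `f' x` at every
point `x`, and for every `x` there is a bounded bilinear form `f'' x` with
`(f' (x + t h) k - f' x k) / t → f'' x h k` as `t → 0`, for all `h` and `k`. The symmetry of
`f'' x` is not asked for, nor is the convergence uniform in `k`. -/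
def IsTwiceGateauxDifferentiable {E : Type*} [NormedAddCommGroup E] [NormedSpace ℝ E]
    (f : E → ℝ) : Prop :=
  ∃ (f' : E → E →L[ℝ] ℝ) (f'' : E → E →L[ℝ] E →L[ℝ] ℝ),
    (∀ x, HasGateauxDerivAt f (f' x) x) ∧
    ∀ x h k : E, HasLineDerivAt ℝ (fun y => f' y k) (f'' x h k) x h

/-- A lower bound for symmetric second differences at `0` is a lower bound for the second
derivative at `0`. -/
theorem le_second_deriv_of_le_second_difference {g g' : ℝ → ℝ} {g₂ c : ℝ}
    (hg : ∀ᶠ t in 𝓝 0, HasDerivAt g (g' t) t) (hg₂ : HasDerivAt g' g₂ 0)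
    (h : ∀ᶠ t in 𝓝 0, c * t ^ 2 ≤ g t + g (-t) - 2 * g 0) : c ≤ g₂ := by
  by_contra! hc
  have hneg : Tendsto (fun t : ℝ => -t) (𝓝 0) (𝓝 0) := by
    simpa using (continuous_neg (G := ℝ)).tendsto 0
  obtain ⟨H, hH⟩ : ∃ H : ℝ → ℝ, H = fun t => g t + g (-t) - c * t ^ 2 := ⟨_, rfl⟩
  have hd : ∀ᶠ t in 𝓝 0, HasDerivAt H (g' t - g' (-t) - 2 * c * t) t := by
    filter_upwards [hg, hneg.eventually hg] with t h1 h2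
    have h3 : HasDerivAt (fun t : ℝ => g (-t)) (g' (-t) * -1) t :=
      HasDerivAt.comp t h2 (hasDerivAt_neg t)
    have h4 : HasDerivAt (fun t : ℝ => c * t ^ 2) (c * (2 * t)) t := by
      simpa using (hasDerivAt_pow 2 t).const_mul c
    rw [hH]
    exact ((h1.fun_add h3).fun_sub h4).congr_deriv (by ring)
  have hd' : deriv H =ᶠ[𝓝 0] fun t => g' t - g' (-t) - 2 * c * t := hd.mono fun t ht => ht.deriv
  have hdd : deriv (deriv H) 0 = 2 * g₂ - 2 * c := by
    rw [hd'.deriv_eq]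
    have h2 : HasDerivAt g' g₂ (-0) := by simpa using hg₂
    have h3 : HasDerivAt (fun t : ℝ => g' (-t)) (g₂ * -1) 0 :=
      HasDerivAt.comp (0 : ℝ) h2 (hasDerivAt_neg 0)
    have h4 : HasDerivAt (fun t : ℝ => 2 * c * t) (2 * c) 0 := by
      simpa using (hasDerivAt_id (0 : ℝ)).const_mul (2 * c)
    rw [((hg₂.fun_sub h3).fun_sub h4).deriv]
    ring
  have hmax : IsLocalMax H 0 := by
    refine isLocalMax_of_deriv_deriv_neg (by rw [hdd]; linarith) ?_
      hd.self_of_nhds.continuousAt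
    rw [hd'.self_of_nhds]
    simp
  have hconst : H =ᶠ[𝓝 0] fun _ => H 0 := by
    filter_upwards [hmax, h] with t h1 h2
    refine le_antisymm h1 ?_
    simp only [hH, neg_zero]
    linarith
  have h0 : deriv (deriv H) 0 = 0 := by
    have h1 : deriv H =ᶠ[𝓝 0] fun _ => 0 := by
      simpa using hconst.deriv
    rw [h1.deriv_eq]
    simp
  rw [hdd] at h0
  linarith

/-- The second derivative of `u ^ (-2)`. -/
theorem HasDerivAt.second_inv_sq {u u' : ℝ → ℝ} {u₂ : ℝ}
    (hu : ∀ᶠ t in 𝓝 0, HasDerivAt u (u' t) t) (hu₂ : HasDerivAt u' u₂ 0) (h0 : u 0 ≠ 0) :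
    (∀ᶠ t in 𝓝 0, HasDerivAt (fun s => (u s ^ 2)⁻¹) (-2 * u' t / u t ^ 3) t) ∧
      HasDerivAt (fun t => -2 * u' t / u t ^ 3)
        (6 * u' 0 ^ 2 / u 0 ^ 4 - 2 * u₂ / u 0 ^ 3) 0 := by
  have hu0 := hu.self_of_nhds
  constructor
  · filter_upwards [hu, hu0.continuousAt.eventually_ne h0] with t h1 h2
    refine ((h1.fun_pow 2).fun_inv (pow_ne_zero 2 h2)).congr_deriv ?_
    push_cast
    field_simp
  · refine ( (hu₂.const_mul (-2)).fun_div (hu0.fun_pow 3) (pow_ne_zero 3 h0)).congr_deriv ?_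
    push_cast
    field_simp
    ring

section Variational

variable {S : Type*} {a : S → ℕ → ℝ} {K : ℝ}

theorem summable_bounded_mul {f : ℕ → ℝ} (hf : ∀ n, 0 ≤ f n) (hs : Summable f) {w : ℕ → ℝ}
    {C : ℝ} (hw : ∀ n, |w n| ≤ C) : Summable fun n => w n * f n := by
  refine Summable.of_norm_bounded (hs.mul_left C) fun n => ?_
  rw [Real.norm_eq_abs, abs_mul, abs_of_nonneg (hf n)]
  exact mul_le_mul_of_nonneg_right (hw n) (hf n)

theorem abs_tsum_bounded_mul_le {f : ℕ → ℝ} (hf : ∀ n, 0 ≤ f n) (hs : Summable f) {w : ℕ → ℝ}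
    {C : ℝ} (hw : ∀ n, |w n| ≤ C) : |∑' n, w n * f n| ≤ C * ∑' n, f n := by
  rw [← tsum_mul_left, ← Real.norm_eq_abs]
  refine tsum_of_norm_bounded (hs.mul_left C).hasSum fun n => ?_
  rw [Real.norm_eq_abs, abs_mul, abs_of_nonneg (hf n)]
  exact mul_le_mul_of_nonneg_right (hw n) (hf n)

/-- A perturbed minimization principle: after a generic perturbation of the weights `w`, the
near-minimizers of `φ - ∑ₙ wₙ aₙ` have uniformly small tails. -/
theorem exists_weight_uniform_tail [Nonempty S] (φ : S → ℝ) (hφ : ∀ y, 0 ≤ φ y)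
    (ha : ∀ y n, 0 ≤ a y n) (hs : ∀ y, Summable (a y)) (hK : ∀ y, ∑' n, a y n ≤ K) :
    ∃ w : ℕ → ℝ, (∀ n, 1 / 2 ≤ w n ∧ w n ≤ 1) ∧ ∀ ε : ℝ, 0 < ε → ∃ N : ℕ, ∃ η : ℝ, 0 < η ∧
      ∀ y, (∀ z, φ y - ∑' n, w n * a y n ≤ φ z - ∑' n, w n * a z n + η) →
        ∑' n, a y (n + N) ≤ ε := by
  obtain ⟨y₁⟩ := ‹Nonempty S›
  have hK0 : 0 ≤ K := (tsum_nonneg (ha y₁)).trans (hK y₁)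
  obtain ⟨F, hF⟩ : ∃ F : (BoundedContinuousFunction ℕ ℝ) → S → ℝ,
    F = fun w y => φ y - ∑' n, w n * a y n := ⟨_, rfl⟩
  have hw : ∀ (w : BoundedContinuousFunction ℕ ℝ) n, |w n| ≤ ‖w‖ := fun w n => w.norm_coe_le_norm n
  have hsw : ∀ (w : BoundedContinuousFunction ℕ ℝ) y, Summable fun n => w n * a y n := fun w y =>
    summable_bounded_mul (ha y) (hs y) (hw w)
  have hbound : ∀ (w : BoundedContinuousFunction ℕ ℝ) y, |∑' n, w n * a y n| ≤ ‖w‖ * K :=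
    fun w y => (abs_tsum_bounded_mul_le (ha y) (hs y) (hw w)).trans
      (mul_le_mul_of_nonneg_left (hK y) (norm_nonneg w))
  have hnear : ∀ (w : BoundedContinuousFunction ℕ ℝ) (η : ℝ), 0 < η → ∃ y, ∀ z,
      F w y ≤ F w z + η := by
    intro w η hη
    have hbdd : BddBelow (range (F w)) := by
      refine ⟨-(‖w‖ * K), ?_⟩
      rintro _ ⟨y, rfl⟩
      have h1 := (abs_le.1 (hbound w y)).2
      have h2 := hφ y
      simp only [hF]
      linarith
    have : Nonempty S := ⟨y₁⟩
    obtain ⟨y, hy⟩ := exists_lt_of_ciInf_lt (show iInf (F w) < iInf (F w) + η by linarith)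
    exact ⟨y, fun z => hy.le.trans (by linarith [ciInf_le hbdd z])⟩
  obtain ⟨U, hU⟩ : ∃ U : ℕ → Set (BoundedContinuousFunction ℕ ℝ), U = fun m : ℕ =>
    {w | ∃ N : ℕ, ∃ η : ℝ, 0 < η ∧ ∀ y, (∀ z, F w y ≤ F w z + η) →
      ∑' n, a y (n + N) ≤ 1 / ((m : ℝ) + 1)} := ⟨_, rfl⟩
  have hopen : ∀ m, IsOpen (U m) := by
    intro m
    rw [Metric.isOpen_iff]
    intro w hwU
    rw [hU] at hwU
    obtain ⟨N, η, hη, hN⟩ := hwU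
    refine ⟨η / (4 * (K + 1)), by positivity, fun v hv => ?_⟩
    rw [hU]
    refine ⟨N, η / 2, by positivity, fun y hy => hN y fun z => ?_⟩
    have hclose : ∀ z, |F v z - F w z| ≤ η / 4 := by
      intro z
      have h1 : F v z - F w z = ∑' n, (w - v) n * a z n := by
        simp only [hF, BoundedContinuousFunction.coe_sub, Pi.sub_apply, sub_mul]
        rw [(hsw w z).tsum_sub (hsw v z)]
        ring
      rw [h1]
      refine (hbound (w - v) z).trans ?_
      rw [← dist_eq_norm, dist_comm]
      have h2 : dist v w < η / (4 * (K + 1)) := hv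
      calc dist v w * K ≤ η / (4 * (K + 1)) * (K + 1) := by gcongr; linarith
        _ = η / 4 := by field_simp
    have h1 := abs_le.1 (hclose y)
    have h2 := abs_le.1 (hclose z)
    have h3 := hy z
    linarith [h1.1, h1.2, h2.1, h2.2]
  have hdense : ∀ m, Dense (U m) := by
    intro m
    rw [Metric.dense_iff]
    intro w r hr
    obtain ⟨γ, hγ⟩ : ∃ γ : ℝ, γ = 1 / ((m : ℝ) + 1) / 3 := ⟨_, rfl⟩
    have hγ0 : 0 < γ := by rw [hγ]; positivity
    obtain ⟨δ, hδ⟩ : ∃ δ : ℝ, δ = r / 2 := ⟨_, rfl⟩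
    have hδ0 : 0 < δ := by rw [hδ]; positivity
    obtain ⟨y₀, hy₀⟩ := hnear w (γ * δ) (by positivity)
    obtain ⟨N, hN⟩ := ((tendsto_sum_nat_add (a y₀)).eventually_le_const hγ0).exists
    obtain ⟨e, he⟩ : ∃ e : BoundedContinuousFunction ℕ ℝ, ∀ n, e n = if N ≤ n then δ else 0 := by
      refine ⟨BoundedContinuousFunction.ofNormedAddCommGroup (fun n => if N ≤ n then δ else 0)
        continuous_of_discreteTopology δ fun n => ?_, fun n => rfl⟩
      split_ifs
      · rw [Real.norm_of_nonneg hδ0.le]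
      · simpa using hδ0.le
    have hee : ∀ y, ∑' n, e n * a y n = δ * ∑' n, a y (n + N) := by
      intro y
      rw [← (hsw e y).sum_add_tsum_nat_add N, Finset.sum_eq_zero, zero_add, ← tsum_mul_left]
      · simp [he]
      · intro n hn
        rw [he, if_neg (by simpa using hn), zero_mul]
    have hFe : ∀ y, F (w - e) y = F w y + δ * ∑' n, a y (n + N) := by
      intro y
      simp only [hF, BoundedContinuousFunction.coe_sub, Pi.sub_apply, sub_mul]
      rw [(hsw w y).tsum_sub (hsw e y), hee]
      ring
    refine ⟨w - e, ?_, ?_⟩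
    · rw [Metric.mem_ball, dist_eq_norm, sub_sub_cancel_left, norm_neg]
      refine lt_of_le_of_lt ((BoundedContinuousFunction.norm_le hδ0.le).2 fun n => ?_)
        (show δ < r by linarith)
      rw [he]
      split_ifs
      · rw [Real.norm_of_nonneg hδ0.le]
      · simpa using hδ0.le
    · rw [hU]
      refine ⟨N, γ * δ, by positivity, fun y hy => ?_⟩
      have h1 := hy y₀
      rw [hFe, hFe] at h1
      have h2 := hy₀ y
      have h3 : δ * ∑' n, a y₀ (n + N) ≤ δ * γ := mul_le_mul_of_nonneg_left hN hδ0.le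
      have h4 : δ * ∑' n, a y (n + N) ≤ δ * (3 * γ) := by linarith
      have h5 := le_of_mul_le_mul_left h4 hδ0
      rw [hγ] at h5
      linarith
  obtain ⟨w, hwU, hwd⟩ := (dense_iInter_of_isOpen_nat hopen hdense).exists_dist_lt
    (BoundedContinuousFunction.const ℕ (3 / 4 : ℝ)) (show (0 : ℝ) < 1 / 4 by norm_num)
  refine ⟨w, fun n => ?_, fun ε hε => ?_⟩
  · have h1 := (BoundedContinuousFunction.dist_coe_le_dist
      (f := BoundedContinuousFunction.const ℕ (3 / 4 : ℝ)) (g := w) n).trans_lt hwd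
    rw [BoundedContinuousFunction.const_apply, Real.dist_eq, abs_lt] at h1
    constructor <;> linarith [h1.1, h1.2]
  · obtain ⟨m, hm⟩ := exists_nat_one_div_lt hε
    have h1 := mem_iInter.1 hwU m
    rw [hU] at h1
    obtain ⟨N, η, hη, hN⟩ := h1
    refine ⟨N, η, hη, fun y hy => (hN y ?_).trans hm.le⟩
    simpa only [hF] using hy

end Variational

namespace OrliczFunction

variable {M : OrliczFunction}

theorem pos_of_not_isDegenerate (hM : ¬ M.IsDegenerate) {t : ℝ} (ht : 0 < t) : 0 < M t :=
  lt_of_le_of_ne (M.nonneg ht.le) fun h => hM ⟨t, ht, h.symm⟩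

theorem mono {s t : ℝ} (hs : 0 ≤ s) (hst : s ≤ t) : M s ≤ M t :=
  M.monotoneOn (mem_Ici.2 hs) (mem_Ici.2 (hs.trans hst)) hst

theorem continuous_abs : Continuous fun t : ℝ => M |t| := by
  rw [← continuousOn_univ]
  exact M.continuousOn.comp _root_.continuous_abs.continuousOn fun t _ => mem_Ici.2 (abs_nonneg t)

theorem exists_scale_two_bound (hM : ¬ M.IsDegenerate) (hΔ : M.DeltaTwoAtZero) (T : ℝ) :
    ∃ C : ℝ, 0 ≤ C ∧ ∀ t, 0 ≤ t → t ≤ T → M (2 * t) ≤ C * M t := by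
  obtain ⟨c, hc0, hc⟩ := exists_between hΔ
  have hb : IsBoundedUnder (· ≥ ·) (𝓝[>] (0 : ℝ)) (fun t : ℝ => M t / M (2 * t)) := by
    refine ⟨0, ?_⟩
    rw [eventually_map]
    filter_upwards [self_mem_nhdsWithin] with t ht
    exact div_nonneg (M.nonneg (le_of_lt ht)) (M.nonneg (by linarith [mem_Ioi.1 ht]))
  have hev := eventually_lt_of_lt_liminf hc hb
  obtain ⟨r, hr, hrs⟩ := mem_nhdsGT_iff_exists_Ioo_subset.1 hev
  have hr0 : 0 < r := hr
  have hMr := pos_of_not_isDegenerate hM hr0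
  refine ⟨max c⁻¹ (M (2 * T) / M r), le_max_of_le_left (by positivity), fun t ht htT => ?_⟩
  rcases ht.eq_or_lt with rfl | ht0
  · simp [M.map_zero]
  rcases lt_or_ge t r with h | h
  · have h1 : c < M t / M (2 * t) := hrs ⟨ht0, h⟩
    have h2 := pos_of_not_isDegenerate hM (show 0 < 2 * t by linarith)
    rw [lt_div_iff₀ h2] at h1
    calc M (2 * t) ≤ c⁻¹ * M t := by
          rw [inv_mul_eq_div, le_div_iff₀ hc0]
          linarith
      _ ≤ _ := mul_le_mul_of_nonneg_right (le_max_left _ _) (M.nonneg ht)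
  · calc M (2 * t) ≤ M (2 * T) := mono (by linarith) (by linarith)
      _ = M (2 * T) / M r * M r := by field_simp
      _ ≤ M (2 * T) / M r * M t := by
          refine mul_le_mul_of_nonneg_left (mono hr0.le h) (div_nonneg (M.nonneg ?_) hMr.le)
          linarith
      _ ≤ _ := mul_le_mul_of_nonneg_right (le_max_right _ _) (M.nonneg ht)

/-- Under the `Δ₂` condition at zero, scaling the argument on a bounded interval costs a
constant factor. -/
theorem exists_scale_bound (hM : ¬ M.IsDegenerate) (hΔ : M.DeltaTwoAtZero) {L : ℝ} (hL : 0 ≤ L)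
    (T : ℝ) : ∃ C : ℝ, 0 ≤ C ∧ ∀ t, 0 ≤ t → t ≤ T → M (L * t) ≤ C * M t := by
  have hpow : ∀ k : ℕ, ∃ C : ℝ, 0 ≤ C ∧ ∀ t, 0 ≤ t → t ≤ T → M (2 ^ k * t) ≤ C * M t := by
    intro k
    induction k with
    | zero => exact ⟨1, zero_le_one, fun t _ _ => by simp⟩
    | succ k ih =>
      obtain ⟨C, hC0, hC⟩ := ih
      obtain ⟨D, hD0, hD⟩ := exists_scale_two_bound hM hΔ (2 ^ k * T)
      refine ⟨D * C, mul_nonneg hD0 hC0, fun t ht htT => ?_⟩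
      have h1 := hD (2 ^ k * t) (by positivity) (by gcongr)
      rw [pow_succ', mul_assoc, mul_assoc]
      exact h1.trans (mul_le_mul_of_nonneg_left (hC t ht htT) hD0)
  obtain ⟨k, hk⟩ := pow_unbounded_of_one_lt L (one_lt_two (α := ℝ))
  obtain ⟨C, hC0, hC⟩ := hpow k
  exact ⟨C, hC0, fun t ht htT =>
    (mono (by positivity) (mul_le_mul_of_nonneg_right hk.le ht)).trans (hC t ht htT)⟩

theorem exists_one_lt (M : OrliczFunction) : ∃ T : ℝ, 0 < T ∧ 1 < M T := by
  obtain ⟨T, h1, h2⟩ :=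
    ((M.tendsto_atTop.eventually_gt_atTop 1).and (eventually_gt_atTop 0)).exists
  exact ⟨T, h2, h1⟩

theorem summable_of_sigma_lt_top {x : ℕ → ℝ} (h : M.sigma x < ∞) :
    Summable fun n => M |x n| := by
  have h1 := ENNReal.summable_toReal h.ne
  refine h1.congr fun n => ?_
  rw [ENNReal.toReal_ofReal (M.nonneg (abs_nonneg _))]

theorem sigma_eq_ofReal_tsum {x : ℕ → ℝ} (h : Summable fun n => M |x n|) :
    M.sigma x = ENNReal.ofReal (∑' n, M |x n|) :=
  (ENNReal.ofReal_tsum_of_nonneg (fun _ => M.nonneg (abs_nonneg _)) h).symm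

namespace Space

theorem norm_le_of_sigma_le_one {x : M.Space} {ρ : ℝ} (hρ : 0 < ρ)
    (h : M.sigma (ρ⁻¹ • x.coords) ≤ 1) : ‖x‖ ≤ ρ := by
  rw [norm_def]
  exact csInf_le ⟨0, fun _ h => h.1.le⟩ ⟨hρ, h⟩

theorem sigma_le_one_of_norm_lt {x : M.Space} {ρ : ℝ} (h : ‖x‖ < ρ) :
    M.sigma (ρ⁻¹ • x.coords) ≤ 1 := by
  rw [norm_def] at h
  obtain ⟨r, ⟨hr, hσ⟩, hrρ⟩ := exists_lt_of_csInf_lt x.exists_sigma_le_one h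
  exact (M.sigma_smul_mono (inv_nonneg.2 (hr.trans hrρ).le) (inv_anti₀ hr hrρ.le) _).trans hσ

theorem exists_coords_bound (M : OrliczFunction) (R : ℝ) :
    ∃ T : ℝ, ∀ x : M.Space, ‖x‖ ≤ R → ∀ n, |x.coords n| ≤ T := by
  obtain ⟨T, hT0, hT⟩ := M.exists_one_lt
  refine ⟨(|R| + 1) * T, fun x hx n => ?_⟩
  have hρ : 0 < |R| + 1 := by positivity
  have h1 : M.sigma ((|R| + 1)⁻¹ • x.coords) ≤ 1 :=
    sigma_le_one_of_norm_lt (by linarith [le_abs_self R])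
  have h2 : ENNReal.ofReal (M |((|R| + 1)⁻¹ • x.coords) n|) ≤ 1 := (ENNReal.le_tsum n).trans h1
  rw [ENNReal.ofReal_le_one, Pi.smul_apply, smul_eq_mul, abs_mul, abs_of_pos (inv_pos.2 hρ)] at h2
  have h3 : (|R| + 1)⁻¹ * |x.coords n| ≤ T := by
    by_contra! h
    exact absurd (mono hT0.le h.le) (not_le.2 (h2.trans_lt hT))
  rwa [inv_mul_le_iff₀ hρ] at h3

/-- The modular is finite, and bounded on bounded sets. -/
theorem exists_modular_bound (hM : ¬ M.IsDegenerate) (hΔ : M.DeltaTwoAtZero) (R : ℝ) :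
    ∃ K : ℝ, ∀ x : M.Space, ‖x‖ ≤ R →
      Summable (fun n => M |x.coords n|) ∧ ∑' n, M |x.coords n| ≤ K := by
  have hρ : 0 < |R| + 1 := by positivity
  obtain ⟨T, hT⟩ := exists_coords_bound M R
  obtain ⟨C, hC0, hC⟩ := exists_scale_bound hM hΔ hρ.le ((|R| + 1)⁻¹ * T)
  refine ⟨C, fun x hx => ?_⟩
  have h1 : M.sigma ((|R| + 1)⁻¹ • x.coords) ≤ 1 :=
    sigma_le_one_of_norm_lt (by linarith [le_abs_self R])
  have h2 := summable_of_sigma_lt_top (h1.trans_lt ENNReal.one_lt_top)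
  have h3 : ∑' n, M |((|R| + 1)⁻¹ • x.coords) n| ≤ 1 := by
    rwa [sigma_eq_ofReal_tsum h2, ENNReal.ofReal_le_one] at h1
  have h4 : ∀ n, M |x.coords n| ≤ C * M |((|R| + 1)⁻¹ • x.coords) n| := by
    intro n
    rw [Pi.smul_apply, smul_eq_mul, abs_mul, abs_of_pos (inv_pos.2 hρ)]
    have h5 := hC ((|R| + 1)⁻¹ * |x.coords n|) (by positivity)
      (mul_le_mul_of_nonneg_left (hT x hx n) (by positivity))
    rwa [mul_inv_cancel_left₀ hρ.ne'] at h5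
  have h5 : Summable fun n => M |x.coords n| :=
    Summable.of_nonneg_of_le (fun n => M.nonneg (abs_nonneg _)) h4 (h2.mul_left C)
  refine ⟨h5, (h5.tsum_le_tsum h4 (h2.mul_left C)).trans ?_⟩
  rw [tsum_mul_left]
  exact mul_le_of_le_one_right hC0 h3

theorem summable_modular (hM : ¬ M.IsDegenerate) (hΔ : M.DeltaTwoAtZero) (x : M.Space) :
    Summable fun n => M |x.coords n| := by
  obtain ⟨K, hK⟩ := exists_modular_bound hM hΔ ‖x‖
  exact (hK x le_rfl).1

theorem tendsto_coords_zero (hM : ¬ M.IsDegenerate) (hΔ : M.DeltaTwoAtZero) (x : M.Space) {r : ℝ}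
    (hr : 0 < r) : ∀ᶠ n in atTop, |x.coords n| < r := by
  have h := (summable_modular hM hΔ x).tendsto_atTop_zero
  filter_upwards [h.eventually_lt_const (pos_of_not_isDegenerate hM hr)] with n hn
  by_contra! h1
  exact absurd (mono hr.le h1) (not_le.2 hn)

/-- The weighted modular `∑ₙ wₙ M(|xₙ|)`. -/
noncomputable def weightedModular (w : ℕ → ℝ) (x : M.Space) : ℝ := ∑' n, w n * M |x.coords n|

theorem continuous_weightedModular (hM : ¬ M.IsDegenerate) (hΔ : M.DeltaTwoAtZero) {w : ℕ → ℝ}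
    (hw0 : ∀ n, 0 ≤ w n) (hw1 : ∀ n, w n ≤ 1) : Continuous (weightedModular (M := M) w) := by
  have hw : ∀ n, |w n| ≤ 1 := fun n => by rw [abs_of_nonneg (hw0 n)]; exact hw1 n
  have hs : ∀ x : M.Space, Summable fun n => w n * M |x.coords n| := fun x =>
    summable_bounded_mul (fun n => M.nonneg (abs_nonneg _)) (summable_modular hM hΔ x) hw
  have hconv : ConvexOn ℝ univ (weightedModular (M := M) w) := by
    refine ⟨convex_univ, fun x _ y _ a b ha hb hab => ?_⟩
    simp only [weightedModular, smul_eq_mul]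
    rw [← tsum_mul_left, ← tsum_mul_left, ← ((hs x).mul_left a).tsum_add ((hs y).mul_left b)]
    refine (hs _).tsum_le_tsum (fun n => ?_) (((hs x).mul_left a).add ((hs y).mul_left b))
    have h := mul_le_mul_of_nonneg_left
      (M.map_abs_combo_le ha hb hab (x.coords n) (y.coords n)) (hw0 n)
    simp only [coords_add, coords_smul, Pi.add_apply, Pi.smul_apply, smul_eq_mul]
    linarith
  rw [← continuousOn_univ]
  have htfae := (hconv.continuousOn_tfae isOpen_univ univ_nonempty).out 3 1
  refine htfae.1 ⟨0, mem_univ _, ?_⟩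
  obtain ⟨K, hK⟩ := exists_modular_bound hM hΔ 1
  refine ⟨K, ?_⟩
  rw [eventually_map]
  filter_upwards [Metric.ball_mem_nhds (0 : M.Space) one_pos] with x hx
  have hx' : ‖x‖ ≤ 1 := by simpa using (mem_ball_zero_iff.1 hx).le
  have h := abs_tsum_bounded_mul_le (fun n => M.nonneg (abs_nonneg (x.coords n)))
    (summable_modular hM hΔ x) hw
  rw [one_mul] at h
  exact (le_abs_self _).trans (h.trans (hK x hx').2)

/-- A bounded sequence in `ℓ_M` with uniformly small modular tails has a convergent
subsequence. -/
theorem exists_tendsto_subseq_of_uniform_tail (hM : ¬ M.IsDegenerate) (hΔ : M.DeltaTwoAtZero)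
    {y : ℕ → M.Space} {R : ℝ} (hy : ∀ i, ‖y i‖ ≤ R)
    (htail : ∀ ε : ℝ, 0 < ε → ∃ N : ℕ, ∀ᶠ i in atTop, ∑' n, M |(y i).coords (n + N)| ≤ ε) :
    ∃ x : M.Space, ∃ θ : ℕ → ℕ, StrictMono θ ∧ Tendsto (y ∘ θ) atTop (𝓝 x) := by
  obtain ⟨T, hT⟩ := exists_coords_bound M R
  obtain ⟨K, hK⟩ := exists_modular_bound hM hΔ R
  have hcpt : IsCompact (Set.pi univ fun _ : ℕ => Icc (-T) T) :=
    isCompact_univ_pi fun _ => isCompact_Icc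
  obtain ⟨x₀, hx₀, θ, hθ, hlim⟩ := hcpt.tendsto_subseq (x := fun i => (y i).coords)
    fun i n _ => abs_le.1 (hT (y i) (hy i) n)
  have hlim' : ∀ n, Tendsto (fun i => (y (θ i)).coords n) atTop (𝓝 (x₀ n)) := fun n =>
    (tendsto_pi_nhds.1 hlim) n
  have hxT : ∀ n, |x₀ n| ≤ T := fun n => abs_le.2 (hx₀ n (mem_univ n))
  have hMlim : ∀ n, Tendsto (fun i => M |(y (θ i)).coords n|) atTop (𝓝 (M |x₀ n|)) := fun n =>
    (M.continuous_abs.tendsto (x₀ n)).comp (hlim' n)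
  have hfatou : ∀ (N : ℕ) (c : ℝ), (∀ᶠ i in atTop, ∑' n, M |(y i).coords (n + N)| ≤ c) →
      Summable (fun n => M |x₀ (n + N)|) ∧ ∑' n, M |x₀ (n + N)| ≤ c := by
    intro N c hc
    have hpart : ∀ u : Finset ℕ, ∑ n ∈ u, M |x₀ (n + N)| ≤ c := by
      intro u
      refine le_of_tendsto (tendsto_finsetSum u fun n _ => hMlim (n + N)) ?_
      filter_upwards [hθ.tendsto_atTop.eventually hc] with i hi
      exact (((summable_nat_add_iff N).2 (summable_modular hM hΔ (y (θ i)))).sum_le_tsum u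
        fun n _ => M.nonneg (abs_nonneg _)).trans hi
    exact ⟨summable_of_sum_le (fun n => M.nonneg (abs_nonneg _)) hpart,
      Real.tsum_le_of_sum_le (fun n => M.nonneg (abs_nonneg _)) hpart⟩
  have hx₀s : Summable fun n => M |x₀ n| :=
    (hfatou 0 K (Eventually.of_forall fun i => by simpa using (hK (y i) (hy i)).2)).1
  obtain ⟨x, hx⟩ : ∃ x : M.Space, x.coords = x₀ := by
    refine ⟨⟨x₀, memℓp_infty ⟨T, ?_⟩, 1, one_pos, ?_⟩, rfl⟩
    · rintro _ ⟨n, rfl⟩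
      exact hxT n
    · rw [inv_one, one_smul, sigma_eq_ofReal_tsum hx₀s]
      exact ENNReal.ofReal_lt_top
  refine ⟨x, θ, hθ, tendsto_iff_norm_sub_tendsto_zero.2 ?_⟩
  rw [Metric.tendsto_nhds]
  intro ρ' hρ'
  obtain ⟨ρ, hρ, hρρ'⟩ := exists_between hρ'
  obtain ⟨C, hC0, hC⟩ := exists_scale_bound hM hΔ (show 0 ≤ 2 * ρ⁻¹ by positivity) T
  obtain ⟨N, hN⟩ := htail (1 / (2 * (C + 1))) (by positivity)
  obtain ⟨hxN, hxN'⟩ := hfatou N _ hN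
  have hfin : Tendsto (fun i => ∑ n ∈ Finset.range N, M |ρ⁻¹ * ((y (θ i)).coords n - x₀ n)|) atTop
      (𝓝 0) := by
    have h : Tendsto (fun i => ∑ n ∈ Finset.range N, M |ρ⁻¹ * ((y (θ i)).coords n - x₀ n)|) atTop
        (𝓝 (∑ n ∈ Finset.range N, M |ρ⁻¹ * (x₀ n - x₀ n)|)) :=
      tendsto_finsetSum _ fun n _ => (M.continuous_abs.tendsto _).comp
        (((hlim' n).sub_const (x₀ n)).const_mul ρ⁻¹)
    simpa [M.map_zero] using h
  filter_upwards [hfin.eventually_le_const (show (0 : ℝ) < 1 / 2 by norm_num),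
    hθ.tendsto_atTop.eventually hN] with i hi1 hi2
  rw [Real.dist_eq, sub_zero, abs_norm]
  refine (norm_le_of_sigma_le_one hρ ?_).trans_lt hρρ'
  have he : ρ⁻¹ • (y (θ i) - x).coords = fun n => ρ⁻¹ * ((y (θ i)).coords n - x₀ n) := by
    rw [← hx]
    rfl
  have hys := summable_modular hM hΔ (y (θ i))
  have hsum : Summable fun n => M |ρ⁻¹ * ((y (θ i)).coords n - x₀ n)| := by
    have h := summable_modular hM hΔ (ρ⁻¹ • (y (θ i) - x))
    rwa [coords_smul, he] at h
  rw [Function.comp_apply, he, sigma_eq_ofReal_tsum hsum, ENNReal.ofReal_le_one,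
    ← hsum.sum_add_tsum_nat_add N]
  have hterm : ∀ n, M |ρ⁻¹ * ((y (θ i)).coords n - x₀ n)| ≤
      C / 2 * (M |(y (θ i)).coords n| + M |x₀ n|) := by
    intro n
    have h1 := M.map_abs_combo_le (a := 1 / 2) (b := 1 / 2) (by norm_num) (by norm_num)
      (by norm_num) (2 * ρ⁻¹ * (y (θ i)).coords n) (-(2 * ρ⁻¹ * x₀ n))
    have h2 : (1 / 2 : ℝ) * (2 * ρ⁻¹ * (y (θ i)).coords n) + 1 / 2 * -(2 * ρ⁻¹ * x₀ n) =
      ρ⁻¹ * ((y (θ i)).coords n - x₀ n) := by ring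
    rw [h2, abs_neg, abs_mul (2 * ρ⁻¹), abs_mul (2 * ρ⁻¹) (x₀ n),
      abs_of_pos (show 0 < 2 * ρ⁻¹ by positivity)] at h1
    have h3 := hC _ (abs_nonneg _) (hT _ (hy (θ i)) n)
    have h4 := hC _ (abs_nonneg _) (hxT n)
    linarith
  have hysN := (summable_nat_add_iff N).2 hys
  have htl : ∑' n, M |ρ⁻¹ * ((y (θ i)).coords (n + N) - x₀ (n + N))| ≤ 1 / 2 := by
    have h1 := ((summable_nat_add_iff N).2 hsum).tsum_le_tsum (fun n => hterm (n + N))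
      ((hysN.add hxN).mul_left (C / 2))
    refine h1.trans ?_
    rw [tsum_mul_left, hysN.tsum_add hxN]
    calc C / 2 * (∑' n, M |(y (θ i)).coords (n + N)| + ∑' n, M |x₀ (n + N)|)
        ≤ C / 2 * (1 / (2 * (C + 1)) + 1 / (2 * (C + 1))) := by gcongr
      _ = C / (C + 1) / 2 := by field_simp; ring
      _ ≤ 1 / 2 := by
          have : C / (C + 1) ≤ 1 := by
            rw [div_le_one (by positivity)]
            linarith
          linarith
  linarith

/-- The unit vectors of `ℓ_M`. -/
theorem exists_unit (M : OrliczFunction) (n : ℕ) :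
    ∃ e : M.Space, e.coords = Pi.single n (1 : ℝ) := by
  have hs : Summable fun m => M |(Pi.single n (1 : ℝ) : ℕ → ℝ) m| := by
    refine summable_of_ne_finset_zero (s := {n}) fun m hm => ?_
    rw [Pi.single_eq_of_ne (by simpa using hm), abs_zero, M.map_zero]
  refine ⟨⟨Pi.single n 1, memℓp_infty ⟨1, ?_⟩, 1, one_pos, ?_⟩, rfl⟩
  · rintro _ ⟨m, rfl⟩
    rcases eq_or_ne m n with rfl | h
    · simp
    · simp [Pi.single_eq_of_ne h]
  · rw [inv_one, one_smul, sigma_eq_ofReal_tsum hs]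
    exact ENNReal.ofReal_lt_top

theorem exists_unit_norm_bound (M : OrliczFunction) :
    ∃ C : ℝ, ∀ (n : ℕ) (e : M.Space), e.coords = Pi.single n (1 : ℝ) → ‖e‖ ≤ C := by
  have h1 : ∀ᶠ t in 𝓝[>] (0 : ℝ), M |t| ≤ 1 := by
    refine eventually_nhdsWithin_of_eventually_nhds ?_
    refine (M.continuous_abs.tendsto 0).eventually_le_const ?_
    rw [abs_zero, M.map_zero]
    exact one_pos
  obtain ⟨t, ht, ht0⟩ := (h1.and self_mem_nhdsWithin).exists
  have ht0' : 0 < t := ht0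
  refine ⟨t⁻¹, fun n e he => norm_le_of_sigma_le_one (inv_pos.2 ht0') ?_⟩
  rw [inv_inv, he, sigma, tsum_eq_single n]
  · simpa using ht
  · intro m hm
    simp [Pi.single_eq_of_ne hm, M.map_zero]

end Space

/-- Where `M'' ≥ B`, second differences of `M |·|` are at least `B t²`. -/
theorem le_second_difference (hd : M.IsTwiceDifferentiable) {B r : ℝ}
    (hr : ∀ t, 0 < t → t < r → B ≤ deriv (deriv M) t) {s t : ℝ} (hs : |s| < r / 2)
    (ht : |t| < r / 2) : B * t ^ 2 ≤ M |s + t| + M |s - t| - 2 * M |s| := by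
  have hr0 : 0 < r := by linarith [abs_nonneg s]
  obtain ⟨H, hH⟩ : ∃ H : ℝ → ℝ, H = fun t => M t - B / 2 * t ^ 2 := ⟨_, rfl⟩
  have hq : ∀ t : ℝ, HasDerivAt (fun t : ℝ => B / 2 * t ^ 2) (B * t) t := fun t => by
    refine ((hasDerivAt_pow 2 t).const_mul (B / 2)).congr_deriv ?_
    push_cast
    ring
  have hH1 : ∀ t, 0 < t → HasDerivAt H (deriv M t - B * t) t := fun t ht => by
    rw [hH]
    exact (hd t ht).1.hasDerivAt.fun_sub (hq t)
  have hH2 : ∀ t, 0 < t → HasDerivAt (deriv H) (deriv (deriv M) t - B) t := fun t ht => by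
    have h1 : HasDerivAt (fun t => deriv M t - B * t) (deriv (deriv M) t - B) t := by
      refine ((hd t ht).2.hasDerivAt.fun_sub ((hasDerivAt_id t).const_mul B)).congr_deriv ?_
      ring
    refine h1.congr_of_eventuallyEq ?_
    filter_upwards [eventually_gt_nhds ht] with u hu
    exact (hH1 u hu).deriv
  have hconv : ConvexOn ℝ (Icc 0 r) H := by
    refine convexOn_of_deriv2_nonneg (convex_Icc 0 r) ?_ ?_ ?_ ?_
    · rw [hH]
      exact (M.continuousOn.mono Icc_subset_Ici_self).sub (by fun_prop)
    · rw [interior_Icc]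
      exact fun t ht => (hH1 t ht.1).differentiableAt.differentiableWithinAt
    · rw [interior_Icc]
      exact fun t ht => (hH2 t ht.1).differentiableAt.differentiableWithinAt
    · rw [interior_Icc]
      intro t ht
      change 0 ≤ deriv (deriv H) t
      rw [(hH2 t ht.1).deriv]
      linarith [hr t ht.1 ht.2]
  have hH0 : H 0 = 0 := by simp [hH, M.map_zero]
  have hscale : ∀ a b, 0 ≤ a → a ≤ b → 0 < b → b ≤ r → H a ≤ a / b * H b := by
    intro a b ha hab hb hbr
    have h := hconv.2 (show b ∈ Icc 0 r from ⟨hb.le, hbr⟩)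
      (show (0 : ℝ) ∈ Icc 0 r from ⟨le_rfl, hr0.le⟩) (show 0 ≤ a / b by positivity)
      (sub_nonneg.2 ((div_le_one hb).2 hab)) (by ring)
    simp only [smul_eq_mul, mul_zero, add_zero, hH0] at h
    rwa [div_mul_cancel₀ a hb.ne'] at h
  have hnonneg : ∀ b, 0 < b → b ≤ r → 0 ≤ H b := by
    intro b hb hbr
    have h1 : ∀ᶠ a in 𝓝[>] (0 : ℝ), -(B / 2 * b * a) ≤ H b := by
      filter_upwards [Ioo_mem_nhdsGT hb] with a ha
      have h2 := hscale a b ha.1.le ha.2.le hb hbr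
      have h3 : -(B / 2 * a ^ 2) ≤ H a := by
        simp only [hH]
        linarith [M.nonneg ha.1.le]
      have h4 : a * (-(B / 2 * b * a)) ≤ a * H b := by
        rw [div_mul_eq_mul_div, le_div_iff₀ hb] at h2
        nlinarith [mul_le_mul_of_nonneg_right h3 hb.le]
      exact le_of_mul_le_mul_left h4 ha.1
    have h2 : Tendsto (fun a : ℝ => -(B / 2 * b * a)) (𝓝[>] 0) (𝓝 0) := by
      have h3 : Continuous fun a : ℝ => -(B / 2 * b * a) := by fun_prop
      simpa using (h3.tendsto 0).mono_left nhdsWithin_le_nhds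
    exact le_of_tendsto h2 h1
  have hmono : ∀ a b, 0 ≤ a → a ≤ b → b ≤ r → H a ≤ H b := by
    intro a b ha hab hbr
    rcases (ha.trans hab).eq_or_lt with h | h
    · rw [← h] at hab
      rw [← h, le_antisymm hab ha]
    · exact (hscale a b ha hab h hbr).trans
        (mul_le_of_le_one_left (hnonneg b h hbr) ((div_le_one h).2 hab))
  have h1 : |s + t| ≤ r := (abs_add_le s t).trans (by linarith)
  have h2 : |s - t| ≤ r := (abs_sub s t).trans (by linarith)
  have h3 : |s| ≤ 1 / 2 * |s + t| + 1 / 2 * |s - t| := by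
    have h := abs_add_le (s + t) (s - t)
    have e : s + t + (s - t) = 2 * s := by ring
    rw [e, abs_mul, abs_two] at h
    linarith
  have h4 := hmono _ _ (abs_nonneg s) h3 (by linarith)
  have h5 := hconv.2 (show |s + t| ∈ Icc 0 r from ⟨abs_nonneg _, h1⟩)
    (show |s - t| ∈ Icc 0 r from ⟨abs_nonneg _, h2⟩) (show (0 : ℝ) ≤ 1 / 2 by norm_num)
    (show (0 : ℝ) ≤ 1 / 2 by norm_num) (by norm_num)
  simp only [smul_eq_mul] at h5
  have h6 := h4.trans h5
  simp only [hH, sq_abs] at h6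
  linarith

end OrliczFunction

theorem HasLineDerivAt.hasDerivAt_line {E : Type*} [NormedAddCommGroup E] [NormedSpace ℝ E]
    {f : E → ℝ} {f' : ℝ} {x h : E} {t : ℝ} (hf : HasLineDerivAt ℝ f f' (x + t • h) h) :
    HasDerivAt (fun s : ℝ => f (x + s • h)) f' t := by
  have h1 : HasDerivAt (fun s : ℝ => f (x + t • h + s • h)) f' (t - t) := by
    rw [sub_self]
    exact hf
  have h2 := h1.comp_sub_const t t
  refine h2.congr_of_eventuallyEq (Eventually.of_forall fun s => ?_)
  simp only [add_assoc, ← add_smul, add_sub_cancel]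

namespace OrliczFunction

variable {M : OrliczFunction}

/-- For a bump `b`, some perturbation `b ^ (-2) - ∑ₙ wₙ M(|xₙ|)` with weights in `[1/2, 1]` attains
its minimum over the support of `b`. -/
theorem exists_weight_isMinOn (hM : ¬ M.IsDegenerate) (hΔ : M.DeltaTwoAtZero) {b : M.Space → ℝ}
    (hb : IsBump b) : ∃ w : ℕ → ℝ, (∀ n, 1 / 2 ≤ w n ∧ w n ≤ 1) ∧ ∃ x : M.Space, b x ≠ 0 ∧
      ∀ z, b z ≠ 0 → (b x ^ 2)⁻¹ - Space.weightedModular w x ≤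
        (b z ^ 2)⁻¹ - Space.weightedModular w z := by
  obtain ⟨R, hR⟩ := isBounded_iff_forall_norm_le.1 hb.isBounded_support
  obtain ⟨K, hK⟩ := Space.exists_modular_bound hM hΔ R
  have : Nonempty (Function.support b) := hb.support_nonempty.to_subtype
  obtain ⟨w, hw, htail⟩ := exists_weight_uniform_tail (S := Function.support b)
    (a := fun y n => M |(y : M.Space).coords n|) (K := K) (fun y => (b y ^ 2)⁻¹)
    (fun y => by positivity) (fun y n => M.nonneg (abs_nonneg _))
    (fun y => (hK y (hR y y.2)).1) (fun y => (hK y (hR y y.2)).2)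
  refine ⟨w, hw, ?_⟩
  obtain ⟨F, hF⟩ : ∃ F : M.Space → ℝ, F = fun y => (b y ^ 2)⁻¹ - Space.weightedModular w y :=
    ⟨_, rfl⟩
  have hG : ∀ y ∈ Function.support b, Space.weightedModular w y ≤ K := by
    intro y hy
    have h1 := abs_tsum_bounded_mul_le (fun n => M.nonneg (abs_nonneg (y.coords n)))
      (hK y (hR y hy)).1 (C := 1) (w := w) fun n => by
        rw [abs_of_nonneg (by linarith [(hw n).1])]
        exact (hw n).2
    rw [one_mul] at h1
    exact (le_abs_self _).trans (h1.trans (hK y (hR y hy)).2)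
  have hbdd : BddBelow (range fun y : Function.support b => F y) := by
    refine ⟨-K, ?_⟩
    rintro _ ⟨y, rfl⟩
    have h1 := hG y y.2
    have h2 : 0 ≤ (b y ^ 2)⁻¹ := by positivity
    simp only [hF]
    linarith
  obtain ⟨m, hm⟩ : ∃ m : ℝ, m = ⨅ y : Function.support b, F y := ⟨_, rfl⟩
  have hmle : ∀ z, b z ≠ 0 → m ≤ F z := fun z hz => by
    rw [hm]
    exact ciInf_le hbdd ⟨z, hz⟩
  have hex : ∀ i : ℕ, ∃ y : Function.support b, F y < m + 1 / ((i : ℝ) + 1) := fun i => by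
    refine exists_lt_of_ciInf_lt ?_
    rw [← hm]
    exact lt_add_of_pos_right _ (by positivity)
  choose y hy using hex
  have hlim : Tendsto (fun i : ℕ => m + 1 / ((i : ℝ) + 1)) atTop (𝓝 m) := by
    simpa using tendsto_one_div_add_atTop_nhds_zero_nat.const_add m
  obtain ⟨x, θ, hθ, hx⟩ := Space.exists_tendsto_subseq_of_uniform_tail hM hΔ
    (y := fun i => (y i : M.Space)) (fun i => hR _ (y i).2) (by
      intro ε hε
      obtain ⟨N, η, hη, hN⟩ := htail ε hε
      refine ⟨N, ?_⟩
      filter_upwards [hlim.eventually_lt_const (show m < m + η by linarith)] with i hi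
      refine hN (y i) fun z => ?_
      have h1 := (hy i).trans hi
      have h2 := hmle z z.2
      simp only [hF, Space.weightedModular] at h1 h2
      linarith)
  have hxb : Tendsto (fun i => b (y (θ i))) atTop (𝓝 (b x)) := (hb.continuous.tendsto x).comp hx
  have hbx : b x ≠ 0 := by
    have h1 : ∀ i, 1 ≤ (m + 1 + K) * b (y (θ i)) ^ 2 := by
      intro i
      have h2 := hy (θ i)
      have h3 := hG _ (y (θ i)).2
      have h4 : 1 / ((θ i : ℝ) + 1) ≤ 1 := by
        rw [div_le_one (by positivity)]
        linarith [(θ i).cast_nonneg (α := ℝ)]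
      have h5 : 0 < b (y (θ i)) ^ 2 := by
        have : b (y (θ i)) ≠ 0 := (y (θ i)).2
        positivity
      have h6 : (b (y (θ i)) ^ 2)⁻¹ ≤ m + 1 + K := by
        simp only [hF] at h2
        linarith
      rwa [inv_le_iff_one_le_mul₀ h5] at h6
    have h2 := ge_of_tendsto' ((hxb.pow 2).const_mul (m + 1 + K)) h1
    intro h0
    rw [h0] at h2
    norm_num at h2
  refine ⟨x, hbx, fun z hz => ?_⟩
  have hcont : Tendsto (fun i => F (y (θ i))) atTop (𝓝 (F x)) := by
    rw [hF]
    exact ((hxb.pow 2).inv₀ (pow_ne_zero 2 hbx)).sub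
      (((Space.continuous_weightedModular hM hΔ (fun n => by linarith [(hw n).1])
        fun n => (hw n).2).tendsto x).comp hx)
  have h1 : F x ≤ m :=
    le_of_tendsto_of_tendsto' hcont (hlim.comp hθ.tendsto_atTop) fun i => (hy (θ i)).le
  have h2 := h1.trans (hmle z hz)
  rwa [hF] at h2

theorem Space.weightedModular_add_smul_unit (hM : ¬ M.IsDegenerate) (hΔ : M.DeltaTwoAtZero)
    {w : ℕ → ℝ} (hw : ∀ n, |w n| ≤ 1) {n : ℕ} {e : M.Space} (he : e.coords = Pi.single n (1 : ℝ))
    (x : M.Space) (t : ℝ) : Space.weightedModular w (x + t • e) - Space.weightedModular w x =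
      w n * (M |x.coords n + t| - M |x.coords n|) := by
  have hs : ∀ x : M.Space, Summable fun n => w n * M |x.coords n| := fun x =>
    summable_bounded_mul (fun n => M.nonneg (abs_nonneg _)) (Space.summable_modular hM hΔ x) hw
  rw [Space.weightedModular, Space.weightedModular, ← (hs _).tsum_sub (hs x), tsum_eq_single n]
  · simp only [Space.coords_add, Space.coords_smul, he, Pi.add_apply, Pi.smul_apply,
      Pi.single_eq_same, smul_eq_mul, mul_one]
    ring
  · intro k hk
    simp only [Space.coords_add, Space.coords_smul, he, Pi.add_apply, Pi.smul_apply,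
      Pi.single_eq_of_ne hk, smul_eq_mul, mul_zero, add_zero, sub_self]

theorem not_exists_twiceGateauxDifferentiable_bump (hM : ¬ M.IsDegenerate)
    (hΔ : M.DeltaTwoAtZero) (hd : M.IsTwiceDifferentiable)
    (hlim : Tendsto (deriv (deriv M)) (𝓝[>] 0) atTop) :
    ¬ ∃ b : M.Space → ℝ, IsBump b ∧ IsTwiceGateauxDifferentiable b := by
  rintro ⟨b, hb, f', f'', hf', hf''⟩
  obtain ⟨w, hw, x, hbx, hmin⟩ := exists_weight_isMinOn hM hΔ hb
  have hw1 : ∀ n, |w n| ≤ 1 := fun n => by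
    rw [abs_of_nonneg (by linarith [(hw n).1])]
    exact (hw n).2
  obtain ⟨C, hC⟩ := Space.exists_unit_norm_bound M
  obtain ⟨D, hD⟩ : ∃ D : ℝ, D = 6 * (‖f' x‖ * C) ^ 2 / |b x| ^ 4 +
    2 * (‖f'' x‖ * C * C) / |b x| ^ 3 := ⟨_, rfl⟩
  obtain ⟨r, hr, hrs⟩ := mem_nhdsGT_iff_exists_Ioo_subset.1
    (hlim.eventually_ge_atTop (2 * (|D| + 1)))
  have hr0 : 0 < r := hr
  obtain ⟨n, hn⟩ := (Space.tendsto_coords_zero hM hΔ x (half_pos hr0)).exists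
  obtain ⟨e, he⟩ := Space.exists_unit M n
  have hC' := hC n e he
  have hC0 : 0 ≤ C := (norm_nonneg e).trans hC'
  have hline : Continuous fun t : ℝ => b (x + t • e) := hb.continuous.comp (by fun_prop)
  have hu : ∀ᶠ t : ℝ in 𝓝 0, HasDerivAt (fun t : ℝ => b (x + t • e)) (f' (x + t • e) e) t :=
    Eventually.of_forall fun t => (hf' (x + t • e) e).hasDerivAt_line
  have hu₂ : HasDerivAt (fun t : ℝ => f' (x + t • e) e) (f'' x e e) 0 := hf'' x e e
  obtain ⟨hg, hg₂⟩ := HasDerivAt.second_inv_sq hu hu₂ (by simpa using hbx)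
  have hne : ∀ᶠ t : ℝ in 𝓝 0, b (x + t • e) ≠ 0 :=
    hline.continuousAt.eventually_ne (by simpa using hbx)
  have hneg : Tendsto (fun t : ℝ => -t) (𝓝 0) (𝓝 0) := by
    simpa using (continuous_neg (G := ℝ)).tendsto 0
  have habs : ∀ᶠ t : ℝ in 𝓝 0, |t| < r / 2 := by
    have h := (_root_.continuous_abs (G := ℝ)).tendsto 0
    rw [abs_zero] at h
    exact h.eventually_lt_const (half_pos hr0)
  have hkey := le_second_deriv_of_le_second_difference (c := |D| + 1) hg hg₂ (by
    filter_upwards [hne, hneg.eventually hne, habs] with t h1 h2 h3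
    have h4 := hmin _ h1
    have h5 := hmin _ h2
    have h6 := Space.weightedModular_add_smul_unit hM hΔ hw1 he x t
    have h7 := Space.weightedModular_add_smul_unit hM hΔ hw1 he x (-t)
    have h8 := le_second_difference hd (B := 2 * (|D| + 1)) (fun s hs hsr => hrs ⟨hs, hsr⟩) hn h3
    have h9 : 1 / 2 * (2 * (|D| + 1) * t ^ 2) ≤
        w n * (M |x.coords n + t| + M |x.coords n - t| - 2 * M |x.coords n|) :=
      mul_le_mul (hw n).1 h8 (by positivity) (by linarith [(hw n).1])
    rw [← sub_eq_add_neg] at h7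
    simp only [zero_smul, add_zero]
    linarith)
  simp only [zero_smul, add_zero] at hkey
  have h1 : |f' x e| ≤ ‖f' x‖ * C :=
    ((f' x).le_opNorm e).trans (mul_le_mul_of_nonneg_left hC' (norm_nonneg _))
  have h2 : |f'' x e e| ≤ ‖f'' x‖ * C * C :=
    ((f'' x).le_opNorm₂ e e).trans (by gcongr)
  have hb0 : 0 < |b x| := abs_pos.2 hbx
  have h3 : 6 * f' x e ^ 2 / b x ^ 4 ≤ 6 * (‖f' x‖ * C) ^ 2 / |b x| ^ 4 := by
    rw [← sq_abs (f' x e), Even.pow_abs (by decide : Even 4)]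
    gcongr
  have h4 : -(2 * f'' x e e / b x ^ 3) ≤ 2 * (‖f'' x‖ * C * C) / |b x| ^ 3 := by
    refine (neg_le_abs _).trans ?_
    rw [abs_div, abs_mul, abs_two, abs_pow]
    gcongr
  linarith [le_abs_self D]

end OrliczFunction

theorem IsBump.comp_linearIsometryEquiv {E F : Type*} [NormedAddCommGroup E] [NormedSpace ℝ E]
    [NormedAddCommGroup F] [NormedSpace ℝ F] {b : F → ℝ} (hb : IsBump b) (L : E ≃ₗᵢ[ℝ] F) :
    IsBump (b ∘ L) := by
  refine ⟨hb.continuous.comp L.continuous, ?_, ?_⟩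
  · obtain ⟨y, hy⟩ := hb.support_nonempty
    exact ⟨L.symm y, by simpa using hy⟩
  · obtain ⟨R, hR⟩ := isBounded_iff_forall_norm_le.1 hb.isBounded_support
    exact isBounded_iff_forall_norm_le.2 ⟨R, fun x hx => by simpa using hR (L x) hx⟩

theorem IsTwiceGateauxDifferentiable.comp_continuousLinearMap {E F : Type*}
    [NormedAddCommGroup E] [NormedSpace ℝ E] [NormedAddCommGroup F] [NormedSpace ℝ F] {f : F → ℝ}
    (hf : IsTwiceGateauxDifferentiable f) (L : E →L[ℝ] F) :
    IsTwiceGateauxDifferentiable (f ∘ L) := by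
  obtain ⟨f', f'', h1, h2⟩ := hf
  refine ⟨fun x => (f' (L x)).comp L, fun x => (f'' (L x)).bilinearComp L L,
    fun x h => ?_, fun x h k => ?_⟩
  · simpa [HasLineDerivAt] using h1 (L x) (L h)
  · simpa [HasLineDerivAt] using h2 (L x) (L h) (L k)

namespace OrliczFunction

/-- The Orlicz function `t ↦ tᵖ`. -/
noncomputable def power (p : ℝ) (hp : 1 ≤ p) : OrliczFunction where
  toFun t := t ^ p
  continuousOn := (Real.continuous_rpow_const (by linarith)).continuousOn
  monotoneOn _ hs _ _ hst := Real.rpow_le_rpow hs hst (by linarith)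
  convexOn := convexOn_rpow hp
  map_zero := Real.zero_rpow (by linarith)
  tendsto_atTop := tendsto_rpow_atTop (by linarith)

variable {p : ℝ} (hp : 1 ≤ p)

theorem power_apply (t : ℝ) : power p hp t = t ^ p := rfl

theorem not_isDegenerate_power : ¬ (power p hp).IsDegenerate := by
  rintro ⟨t, ht, h⟩
  exact (Real.rpow_pos_of_pos ht p).ne' h

theorem deltaTwoAtZero_power : (power p hp).DeltaTwoAtZero := by
  have h : (fun t : ℝ => power p hp t / power p hp (2 * t)) =ᶠ[𝓝[>] 0] fun _ => (2 ^ p)⁻¹ := by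
    filter_upwards [self_mem_nhdsWithin] with t ht
    have h1 : 0 < t ^ p := Real.rpow_pos_of_pos ht p
    rw [power_apply, power_apply, Real.mul_rpow two_pos.le (le_of_lt ht)]
    field_simp
  rw [DeltaTwoAtZero, liminf_congr h, liminf_const]
  positivity

theorem hasDerivAt_power {t : ℝ} (ht : 0 < t) : HasDerivAt (power p hp) (p * t ^ (p - 1)) t :=
  Real.hasDerivAt_rpow_const (Or.inl ht.ne')

theorem hasDerivAt_deriv_power {t : ℝ} (ht : 0 < t) :
    HasDerivAt (deriv (power p hp)) (p * ((p - 1) * t ^ (p - 1 - 1))) t := by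
  refine ((Real.hasDerivAt_rpow_const (Or.inl ht.ne')).const_mul p).congr_of_eventuallyEq ?_
  filter_upwards [eventually_gt_nhds ht] with u hu
  exact (hasDerivAt_power hp hu).deriv

theorem isTwiceDifferentiable_power : (power p hp).IsTwiceDifferentiable := fun _ ht =>
  ⟨(hasDerivAt_power hp ht).differentiableAt, (hasDerivAt_deriv_power hp ht).differentiableAt⟩

theorem tendsto_deriv_deriv_power (hp1 : 1 < p) (hp2 : p < 2) :
    Tendsto (deriv (deriv (power p hp))) (𝓝[>] 0) atTop := by
  have h : Tendsto (fun t : ℝ => p * ((p - 1) * t ^ (p - 1 - 1))) (𝓝[>] 0) atTop :=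
    ((tendsto_rpow_neg_nhdsGT_zero (by linarith)).const_mul_atTop
      (by linarith)).const_mul_atTop (by linarith)
  refine h.congr' ?_
  filter_upwards [self_mem_nhdsWithin] with t ht
  exact (hasDerivAt_deriv_power hp ht).deriv.symm

theorem sigma_power_coe_lp {q : ℝ≥0∞} (hq : 1 ≤ q.toReal) (f : lp (fun _ : ℕ => ℝ) q) :
    (power q.toReal hq).sigma f = ENNReal.ofReal (‖f‖ ^ q.toReal) := by
  have hq0 : 0 < q.toReal := by linarith
  have h := (lp.hasSum_norm hq0 f)
  rw [sigma_eq_ofReal_tsum]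
  · rw [← h.tsum_eq]
    rfl
  · exact h.summable

/-- `ℓ_p` is the Orlicz sequence space of `t ↦ tᵖ`. -/
noncomputable def powerSpaceEquivLp (q : ℝ≥0∞) [Fact (1 ≤ q)] (hq : 1 ≤ q.toReal) :
    (power q.toReal hq).Space ≃ₗᵢ[ℝ] lp (fun _ : ℕ => ℝ) q where
  toFun x := ⟨x.coords, memℓp_gen (Space.summable_modular (not_isDegenerate_power hq)
    (deltaTwoAtZero_power hq) x)⟩
  map_add' _ _ := rfl
  map_smul' _ _ := rfl
  invFun f := ⟨f, (lp.memℓp f).of_exponent_ge le_top, 1, one_pos, by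
    rw [inv_one, one_smul, sigma_power_coe_lp]
    exact ENNReal.ofReal_lt_top⟩
  left_inv _ := rfl
  right_inv _ := rfl
  norm_map' x := by
    have hq0 : 0 < q.toReal := by linarith
    change ‖(⟨x.coords, memℓp_gen (Space.summable_modular (not_isDegenerate_power hq)
      (deltaTwoAtZero_power hq) x)⟩ : lp (fun _ : ℕ => ℝ) q)‖ = ‖x‖
    obtain ⟨f, hf⟩ : ∃ f : lp (fun _ : ℕ => ℝ) q, f =
      ⟨x.coords, memℓp_gen (Space.summable_modular (not_isDegenerate_power hq)
        (deltaTwoAtZero_power hq) x)⟩ := ⟨_, rfl⟩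
    rw [← hf]
    have hiff : ∀ ρ : ℝ, 0 < ρ →
        ((power q.toReal hq).sigma (ρ⁻¹ • x.coords) ≤ 1 ↔ ‖f‖ ≤ ρ) := by
      intro ρ hρ
      have h1 : ρ⁻¹ • x.coords = ((ρ⁻¹ • f : lp (fun _ : ℕ => ℝ) q) : ℕ → ℝ) := by
        rw [hf]
        rfl
      rw [h1, sigma_power_coe_lp, ENNReal.ofReal_le_one, norm_smul, norm_inv,
        Real.norm_of_nonneg hρ.le, ← Real.one_rpow q.toReal,
        Real.rpow_le_rpow_iff (by positivity) zero_le_one hq0, inv_mul_le_iff₀ hρ, mul_one]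
    refine le_antisymm (le_of_forall_gt_imp_ge_of_dense fun ρ hρ => ?_)
      (le_of_forall_gt_imp_ge_of_dense fun ρ hρ => ?_)
    · exact (hiff ρ ((norm_nonneg x).trans_lt hρ)).1 (Space.sigma_le_one_of_norm_lt hρ)
    · have hρ0 := (norm_nonneg f).trans_lt hρ
      exact Space.norm_le_of_sigma_le_one hρ0 ((hiff ρ hρ0).2 hρ.le)

end OrliczFunction

theorem proposition5p3 :
    (∀ M : OrliczFunction, ¬ M.IsDegenerate → M.DeltaTwoAtZero → M.IsTwiceDifferentiable →
      Tendsto (deriv (deriv M)) (𝓝[>] 0) atTop →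
      ¬ ∃ b : M.Space → ℝ, IsBump b ∧ IsTwiceGateauxDifferentiable b) ∧
    (∀ (p : ℝ≥0∞) [Fact (1 ≤ p)], 1 < p → p < 2 →
      ¬ ∃ b : lp (fun _ : ℕ => ℝ) p → ℝ, IsBump b ∧ IsTwiceGateauxDifferentiable b) := by
  refine ⟨fun M hM hΔ hd hlim =>
    OrliczFunction.not_exists_twiceGateauxDifferentiable_bump hM hΔ hd hlim, ?_⟩
  rintro p _ hp1 hp2 ⟨b, hb, hb'⟩
  have hptop : p ≠ ∞ := hp2.ne_top
  have h1 : 1 < p.toReal := by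
    rw [← ENNReal.toReal_one]
    exact (ENNReal.toReal_lt_toReal ENNReal.one_ne_top hptop).2 hp1
  have h2 : p.toReal < 2 := by
    rw [← ENNReal.toReal_ofNat 2]
    exact (ENNReal.toReal_lt_toReal hptop ENNReal.ofNat_ne_top).2 hp2
  have L := OrliczFunction.powerSpaceEquivLp p h1.le
  exact OrliczFunction.not_exists_twiceGateauxDifferentiable_bump
    (OrliczFunction.not_isDegenerate_power h1.le) (OrliczFunction.deltaTwoAtZero_power h1.le)
    (OrliczFunction.isTwiceDifferentiable_power h1.le)
    (OrliczFunction.tendsto_deriv_deriv_power h1.le h1 h2)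
    ⟨b ∘ L, hb.comp_linearIsometryEquiv L,
      hb'.comp_continuousLinearMap L.toContinuousLinearEquiv.toContinuousLinearMap⟩
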